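/- Let $\Bbbk$ be an algebraically closed field of characteristic zero and let $H=(H,m,\eta,\Delta,\varepsilon,S)$ be a finite-dimensional factorizable ribbon Hopf algebra over $\Bbbk$. That is, $H$ is endowed with an invertible $R\in H\otimes H$ satisfying $R\,\Delta(h)\,R^{-1}=\Delta^{\mathrm{op}}(h)$ for all $h\in H$, $(\Delta\otimes\mathrm{id})(R)=R_{13}R_{23}$ and $(\mathrm{id}\otimes\Delta)(R)=R_{13}R_{12}$; with a central invertible element $v\in H$ such that $S(v)=v$, $\varepsilon(v)=1$ and $\Delta(v)=(v\otimes v)\,Q^{-1}$, where $Q=R_{21}R$; and $Q=\sum_\ell h_\ell\otimes k_\ell$ for two vector space bases $(h_\ell)$, $(k_\ell)$ of $H$. Let $\Lambda\in H$ be a left integral ($h\Lambda=\varepsilon(h)\Lambda$ for all $h\in H$) and $\lambda\in H^*$ a right cointegral ($\lambda(h_{(1)})\,h_{(2)}=\lambda(h)\,1$ for all $h\in H$), normalized so that $\lambda(\Lambda)=1$. Consider the category of $H$-bimodules, with tensor product the tensor product over $\Bbbk$ on which $H$ acts from the left and from the right through its coproduct, and with unit object $\Bbbk$ on which $H$ acts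 on both sides through $\varepsilon$. Let $F$ be the coregular bimodule: $F=H^*$ with actions $(h\cdot p)(x)=p(S(h)\,x)$ and $(p\cdot h)(x)=p(x\,S^{-1}(h))$. Identify $H^*\otimes H^*$ with $(H\otimes H)^*$ by $(p\otimes q)(x\otimes y)=q(x)\,p(y)$, and define linear maps $m_F:F\otimes F\to F$, $\eta_F:\Bbbk\to F$, $\Delta_F:F\to F\otimes F$ and $\varepsilon_F:F\to\Bbbk$ by $$m_F(p\otimes q)(x)=q(x_{(1)})\,p(x_{(2)}),\qquad \eta_F(1)=\varepsilon,\qquad \Delta_F(p)(x\otimes y)=p(x_{(1)})\,\lambda(S(x_{(2)})\,y),\qquad \varepsilon_F(p)=p(\Lambda).$$ Then $(F,m_F,\eta_F,\Delta_F,\varepsilon_F)$ is a Frobenius algebra in the monoidal category of $H$-bimodules (the four maps are bimodule morphisms, $(F,m_F,\eta_F)$ is an associative unital algebra, $(F,\Delta_F,\varepsilon_F)$ is a coassociative counital coalgebra, and $(m_F\otimes\mathrm{id})\circ(\mathrm{id}\otimes\Delta_F)=\Delta_F\circ m_F=(\mathrm{id}\otimes m_F)\circ(\Delta_F\otimes\mathrm{id})$).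 Moreover, $$\varepsilon_F\circ\eta_F=\varepsilon(\Lambda)\,\mathrm{id}_{\Bbbk}\qquad\text{and}\qquad m_F\circ\Delta_F=\lambda(1)\,\mathrm{id}_F ,$$ and the Frobenius algebra $F$ is special, that is, $\varepsilon_F\circ\eta_F=\xi\,\mathrm{id}_{\Bbbk}$ and $m_F\circ\Delta_F=\zeta\,\mathrm{id}_F$ for some non-zero $\xi,\zeta\in\Bbbk$, if and only if $H$ is semisimple as a ring. -/

import Mathlib

open scoped TensorProduct

noncomputable section

namespace HopfBimod

/-! ### Ribbon and factorizable structures on a Hopf algebra -/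

section Hopf

variable {k H : Type*} [Field k] [Ring H] [HopfAlgebra k H]

/-- `R₁₂ = R ⊗ 1` in `H ⊗ (H ⊗ H)`. -/
def leg12 : H ⊗[k] H →ₗ[k] H ⊗[k] (H ⊗[k] H) :=
  TensorProduct.map LinearMap.id ((TensorProduct.mk k H H).flip 1)

/-- `R₁₃` in `H ⊗ (H ⊗ H)`: the linear map `x ⊗ y ↦ x ⊗ (1 ⊗ y)`. -/
def leg13 : H ⊗[k] H →ₗ[k] H ⊗[k] (H ⊗[k] H) :=
  TensorProduct.map LinearMap.id (TensorProduct.mk k H H 1)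

/-- `R₂₃ = 1 ⊗ R` in `H ⊗ (H ⊗ H)`. -/
def leg23 : H ⊗[k] H →ₗ[k] H ⊗[k] (H ⊗[k] H) :=
  TensorProduct.mk k H (H ⊗[k] H) 1

/-- `R` is an R-matrix for the Hopf algebra `H`: it is invertible, `Δᵒᵖ(h) = R Δ(h) R⁻¹` for all
`h`, `(Δ ⊗ id)(R) = R₁₃ R₂₃` and `(id ⊗ Δ)(R) = R₁₃ R₁₂`. -/
structure IsRMatrix (R : H ⊗[k] H) : Prop where
  isUnit : IsUnit R
  intertwines : ∀ h : H,
    R * Coalgebra.comul (R := k) h =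
      TensorProduct.comm k H H (Coalgebra.comul (R := k) h) * R
  comul_left :
    TensorProduct.assoc k H H H (TensorProduct.map Coalgebra.comul LinearMap.id R) =
      leg13 R * leg23 R
  comul_right :
    TensorProduct.map LinearMap.id Coalgebra.comul R = leg13 R * leg12 R

/-- The monodromy matrix `Q = R₂₁ R`. -/
def monodromy (R : H ⊗[k] H) : H ⊗[k] H :=
  TensorProduct.comm k H H R * R

/-- `v` is a ribbon element of the quasitriangular Hopf algebra `(H, R)`: it is central and
invertible, `S(v) = v`, `ε(v) = 1` and `Δ(v) = (v ⊗ v) Q⁻¹`. -/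
structure IsRibbonElement (R : H ⊗[k] H) (v : H) : Prop where
  central : ∀ h : H, v * h = h * v
  isUnit : IsUnit v
  antipode_eq : HopfAlgebra.antipode k v = v
  counit_eq : Coalgebra.counit (R := k) v = 1
  comul_eq : Coalgebra.comul (R := k) v = (v ⊗ₜ[k] v) * Ring.inverse (monodromy R)

/-- The quasitriangular Hopf algebra `(H, R)` is factorizable: the monodromy matrix is
`∑ hₗ ⊗ kₗ` for two vector space bases `(hₗ)` and `(kₗ)` of `H`. -/
def IsFactorizable (R : H ⊗[k] H) : Prop :=
  ∃ b c : Module.Basis (Fin (Module.finrank k H)) k H, monodromy R = ∑ l, b l ⊗ₜ[k] c l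

variable (k) in
/-- `Λ` is a left integral of `H`: `h Λ = ε(h) Λ` for all `h`. -/
def IsLeftIntegral (Λ : H) : Prop :=
  ∀ h : H, h * Λ = Coalgebra.counit (R := k) h • Λ

/-- `lam` is a right cointegral of `H`: `(lam ⊗ id) ∘ Δ = η ∘ lam`. -/
def IsRightCointegral (lam : Module.Dual k H) : Prop :=
  ∀ h : H, TensorProduct.lid k H (TensorProduct.map lam LinearMap.id (Coalgebra.comul h)) =
    lam h • (1 : H)

variable (k H) in
/-- The inverse `S⁻¹` of the antipode under composition. (The antipode of a finite-dimensional
Hopf algebra is bijective.) -/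
def antipodeInv : H →ₗ[k] H :=
  Ring.inverse (HopfAlgebra.antipode k : Module.End k H)

end Hopf

/-! ### The monoidal category of `H`-bimodules -/

/-- A pair of linear maps `H ⊗ X → X` and `X ⊗ H → X`, in curried form:
`left h x = h · x` and `right h x = x · h`. -/
structure Actions (k H X : Type*) [Field k] [Ring H] [HopfAlgebra k H]
    [AddCommGroup X] [Module k X] where
  left : H →ₗ[k] X →ₗ[k] X
  right : H →ₗ[k] X →ₗ[k] X

namespace Actions

variable {k H X Y : Type*} [Field k] [Ring H] [HopfAlgebra k H]
  [AddCommGroup X] [Module k X] [AddCommGroup Y] [Module k Y]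

/-- `(X, left, right)` is an `H`-bimodule. -/
structure IsBimodule (A : Actions k H X) : Prop where
  left_one : ∀ x : X, A.left 1 x = x
  left_mul : ∀ (g h : H) (x : X), A.left (g * h) x = A.left g (A.left h x)
  right_one : ∀ x : X, A.right 1 x = x
  right_mul : ∀ (g h : H) (x : X), A.right (g * h) x = A.right h (A.right g x)
  left_right : ∀ (g h : H) (x : X), A.left g (A.right h x) = A.right h (A.left g x)

/-- `f` is a morphism of `H`-bimodules. -/
structure IsHom (A : Actions k H X) (B : Actions k H Y) (f : X →ₗ[k] Y) : Prop where
  left : ∀ (h : H) (x : X), f (A.left h x) = B.left h (f x)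
  right : ∀ (h : H) (x : X), f (A.right h x) = B.right h (f x)

/-- The tensor product over `k`, with `H` acting on both sides through its coproduct. -/
def tensor (A : Actions k H X) (B : Actions k H Y) : Actions k H (X ⊗[k] Y) where
  left := TensorProduct.lift
    ((TensorProduct.mapBilinear (RingHom.id k) X Y X Y).compl₁₂ A.left B.left) ∘ₗ Coalgebra.comul
  right := TensorProduct.lift
    ((TensorProduct.mapBilinear (RingHom.id k) X Y X Y).compl₁₂ A.right B.right) ∘ₗ Coalgebra.comul

variable (k H) in
/-- The monoidal unit: `k` with both actions given by the counit. -/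
def unit : Actions k H k where
  left := LinearMap.lsmul k k ∘ₗ Coalgebra.counit
  right := LinearMap.lsmul k k ∘ₗ Coalgebra.counit

variable (k H) in
/-- The coregular bimodule `H*`: `(h · p)(x) = p (S(h) x)` and `(p · h)(x) = p (x S⁻¹(h))`. -/
def coregular : Actions k H (Module.Dual k H) where
  left := Module.Dual.transpose ∘ₗ LinearMap.mul k H ∘ₗ HopfAlgebra.antipode k
  right := Module.Dual.transpose ∘ₗ (LinearMap.mul k H).flip ∘ₗ antipodeInv k H

end Actions

/-! ### Frobenius algebras in the category of `H`-bimodules -/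

/-- The structure maps of a Frobenius algebra with underlying vector space `A`. -/
structure FrobeniusData (k A : Type*) [Field k] [AddCommGroup A] [Module k A] where
  mul : A ⊗[k] A →ₗ[k] A
  unit : k →ₗ[k] A
  comul : A →ₗ[k] A ⊗[k] A
  counit : A →ₗ[k] k

section Frobenius

variable {k H A : Type*} [Field k] [Ring H] [HopfAlgebra k H] [AddCommGroup A] [Module k A]

/-- `(A, m, η, Δ, ε)` is a Frobenius algebra in the monoidal category of `H`-bimodules: `A` is a
bimodule, the four structure maps are bimodule morphisms, `(A, m, η)` is an associative unital
algebra, `(A, Δ, ε)` is a coassociative counital coalgebra, and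
`(m ⊗ id) ∘ (id ⊗ Δ) = Δ ∘ m = (id ⊗ m) ∘ (Δ ⊗ id)`. -/
structure IsFrobeniusAlgebra (act : Actions k H A) (F : FrobeniusData k A) : Prop where
  isBimodule : act.IsBimodule
  mul_hom : (act.tensor act).IsHom act F.mul
  unit_hom : (Actions.unit k H).IsHom act F.unit
  comul_hom : act.IsHom (act.tensor act) F.comul
  counit_hom : act.IsHom (Actions.unit k H) F.counit
  mul_assoc : F.mul ∘ₗ F.mul.rTensor A =
    F.mul ∘ₗ F.mul.lTensor A ∘ₗ (TensorProduct.assoc k A A A).toLinearMap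
  unit_mul : F.mul ∘ₗ F.unit.rTensor A = (TensorProduct.lid k A).toLinearMap
  mul_unit : F.mul ∘ₗ F.unit.lTensor A = (TensorProduct.rid k A).toLinearMap
  comul_coassoc : (TensorProduct.assoc k A A A).toLinearMap ∘ₗ F.comul.rTensor A ∘ₗ F.comul =
    F.comul.lTensor A ∘ₗ F.comul
  counit_comul : (TensorProduct.lid k A).toLinearMap ∘ₗ F.counit.rTensor A ∘ₗ F.comul =
    LinearMap.id
  comul_counit : (TensorProduct.rid k A).toLinearMap ∘ₗ F.counit.lTensor A ∘ₗ F.comul =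
    LinearMap.id
  frobenius_left : F.mul.rTensor A ∘ₗ (TensorProduct.assoc k A A A).symm.toLinearMap ∘ₗ
    F.comul.lTensor A = F.comul ∘ₗ F.mul
  frobenius_right : F.mul.lTensor A ∘ₗ (TensorProduct.assoc k A A A).toLinearMap ∘ₗ
    F.comul.rTensor A = F.comul ∘ₗ F.mul

/-- A Frobenius algebra `A` in `H`-bimodules is special iff `ε ∘ η = ξ id` and `m ∘ Δ = ζ id_A`
with non-zero scalars `ξ` and `ζ`. -/
structure IsSpecialFrobeniusAlgebra (act : Actions k H A) (F : FrobeniusData k A) : Prop where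
  isFrobeniusAlgebra : IsFrobeniusAlgebra act F
  counit_unit : ∃ ξ : k, ξ ≠ 0 ∧ F.counit ∘ₗ F.unit = ξ • LinearMap.id
  mul_comul : ∃ ζ : k, ζ ≠ 0 ∧ F.mul ∘ₗ F.comul = ζ • LinearMap.id

end Frobenius

/-! ### The coregular Frobenius algebra -/

section Coregular

variable {k H : Type*} [Field k] [Ring H] [HopfAlgebra k H] [FiniteDimensional k H]

variable (k H) in
/-- The identification `H* ⊗ H* ≃ (H ⊗ H)*` used for categorical duals, with nested pairing:
`p ⊗ q` sends `x ⊗ y` to `q(x) p(y)`. It is for this pairing that the dual `Δ^∨` of the coproduct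
is a morphism of bimodules. -/
def nestedDual : Module.Dual k H ⊗[k] Module.Dual k H ≃ₗ[k] Module.Dual k (H ⊗[k] H) :=
  TensorProduct.comm k (Module.Dual k H) (Module.Dual k H) ≪≫ₗ TensorProduct.dualDistribEquiv k H H

/-- The map `H ⊗ H → H`, `x ⊗ y ↦ x₁ lam(S(x₂) y)`, that is
`(id ⊗ (lam ∘ m)) ∘ (id ⊗ S ⊗ id) ∘ (Δ ⊗ id)`. -/
def preComul (lam : Module.Dual k H) : H ⊗[k] H →ₗ[k] H :=
  (TensorProduct.rid k H).toLinearMap ∘ₗ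
    (lam ∘ₗ LinearMap.mul' k H).lTensor H ∘ₗ
    ((HopfAlgebra.antipode k : H →ₗ[k] H).rTensor H).lTensor H ∘ₗ
    (TensorProduct.assoc k H H H).toLinearMap ∘ₗ
    (Coalgebra.comul : H →ₗ[k] H ⊗[k] H).rTensor H

/-- The structure maps on `F = H*`: `m = Δ^∨`, `η = ε^∨`, `Δ_F = (preComul lam)^∨` and
`ε_F = Λ^∨`. -/
def coregularFrobenius (Λ : H) (lam : Module.Dual k H) : FrobeniusData k (Module.Dual k H) where
  mul := (Coalgebra.comul : H →ₗ[k] H ⊗[k] H).dualMap ∘ₗ (nestedDual k H).toLinearMap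
  unit := LinearMap.toSpanSingleton k (Module.Dual k H) Coalgebra.counit
  comul := (nestedDual k H).symm.toLinearMap ∘ₗ (preComul lam).dualMap
  counit := Module.Dual.eval k H Λ

end Coregular

end HopfBimod

end

/-! All four structure maps of F are transposes, so the Frobenius axioms are statements about `H`
itself, with Δ, ε, the product μ(x ⊗ y) = x₁ λ(S(x₂) y) of `preComul` and the unit Λ. The cointegral
identity λ(x₁ y) x₂ = λ(x y₁) S(y₂) (`slice_comul_mul`) drives everything. At y = Λ it makes λ(ab) a
nondegenerate form with dual bases Λ₁ ⊗ S(Λ₂), whence S is bijective. With S(x) for x it yields a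
second formula μ(x ⊗ y) = λ(S(x) y₁) y₂. The first formula makes μ left colinear, the second right
colinear. These are the Frobenius relations, and right colinearity also gives associativity.

Left linearity of μ is formal, but right linearity of μ and of ε_F uses that Λ is two-sided
(`unimodular`). The modular character of Λ and ε both send the first leg of Q to 1, because v is
central and fixed by S, and factorizability makes them equal. Then λ(ab) = λ(S²(b) a), so λ is
invariant under w ↦ S(h₁) w h₂.

The scalars are ε(Λ) and λ(1). By Maschke, ε(Λ) ≠ 0 iff `H` is semisimple. In that case λ(1) ≠ 0 as
well: z = (λ ⊗ id)(Q) is an integral with ε(z) = λ(1), hence a multiple of Λ, and λ(1) = 0 would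
force z = 0 and then λ = 0. -/

namespace HopfBimod

open Coalgebra HopfAlgebra

/-! ### Sweedler calculus and the antipode -/

section Sweedler

variable {k H : Type*} [Field k] [Ring H] [HopfAlgebra k H]

/-- Coassociativity tested against a linear map; each later identity in three Sweedler legs is
obtained by choosing `f`. -/
theorem sum_coassoc {M : Type*} [AddCommGroup M] [Module k M] (f : H ⊗[k] (H ⊗[k] H) →ₗ[k] M)
    (h : H) :
    ∑ i ∈ (ℛ k h).index, ∑ j ∈ (ℛ k ((ℛ k h).left i)).index,
      f ((ℛ k ((ℛ k h).left i)).left j ⊗ₜ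
        ((ℛ k ((ℛ k h).left i)).right j ⊗ₜ (ℛ k h).right i)) =
    ∑ i ∈ (ℛ k h).index, ∑ j ∈ (ℛ k ((ℛ k h).right i)).index,
      f ((ℛ k h).left i ⊗ₜ
        ((ℛ k ((ℛ k h).right i)).left j ⊗ₜ (ℛ k ((ℛ k h).right i)).right j)) := by
  simpa only [map_sum] using congrArg f
    (sum_tmul_tmul_eq (ℛ k h) (fun i => ℛ k ((ℛ k h).left i)) (fun i => ℛ k ((ℛ k h).right i)))

theorem comul_eq_sum (h : H) :
    (comul h : H ⊗[k] H) = ∑ i ∈ (ℛ k h).index, (ℛ k h).left i ⊗ₜ (ℛ k h).right i :=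
  (ℛ k h).eq.symm

theorem sum_counit_smul_right (h : H) :
    ∑ i ∈ (ℛ k h).index, counit (R := k) ((ℛ k h).left i) • (ℛ k h).right i = h :=
  sum_counit_smul (ℛ k h)

theorem sum_counit_smul_left (h : H) :
    ∑ i ∈ (ℛ k h).index, counit (R := k) ((ℛ k h).right i) • (ℛ k h).left i = h := by
  simpa only [map_sum, TensorProduct.rid_tmul, one_smul]
    using congrArg (TensorProduct.rid k H) (sum_tmul_counit_eq (R := k) (ℛ k h))

theorem sum_antipode_tmul_one_mul_comul (h : H) :
    ∑ i ∈ (ℛ k h).index,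
      (antipode k ((ℛ k h).left i) ⊗ₜ[k] (1 : H)) * comul ((ℛ k h).right i) = 1 ⊗ₜ h := by
  have := sum_coassoc ((LinearMap.mul' k H ∘ₗ (antipode k).rTensor H).rTensor H ∘ₗ
    (TensorProduct.assoc k H H H).symm.toLinearMap) h
  simp only [LinearMap.comp_apply, LinearEquiv.coe_coe, TensorProduct.assoc_symm_tmul,
    LinearMap.rTensor_tmul, LinearMap.mul'_apply] at this
  simp_rw [comul_eq_sum ((ℛ k h).right _), Finset.mul_sum,
    Algebra.TensorProduct.tmul_mul_tmul, one_mul]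
  rw [← this]
  simp_rw [← TensorProduct.sum_tmul, sum_antipode_mul_eq_smul, TensorProduct.smul_tmul,
    ← TensorProduct.tmul_sum, sum_counit_smul_right]

theorem sum_comul_mul_one_tmul_antipode (h : H) :
    ∑ i ∈ (ℛ k h).index,
      comul ((ℛ k h).left i) * ((1 : H) ⊗ₜ[k] antipode k ((ℛ k h).right i)) = h ⊗ₜ 1 := by
  have := sum_coassoc ((LinearMap.mul' k H ∘ₗ (antipode k).lTensor H).lTensor H) h
  simp only [LinearMap.lTensor_tmul, LinearMap.comp_apply, LinearMap.mul'_apply] at this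
  simp_rw [comul_eq_sum ((ℛ k h).left _), Finset.sum_mul,
    Algebra.TensorProduct.tmul_mul_tmul, mul_one]
  rw [this]
  simp_rw [← TensorProduct.tmul_sum, sum_mul_antipode_eq_smul, ← TensorProduct.smul_tmul,
    ← TensorProduct.sum_tmul, sum_counit_smul_left]

theorem sum_mul_antipode_tmul (h : H) :
    ∑ i ∈ (ℛ k h).index, ∑ j ∈ (ℛ k ((ℛ k h).right i)).index,
      ((ℛ k h).left i * antipode k ((ℛ k ((ℛ k h).right i)).left j)) ⊗ₜ[k]
        (ℛ k ((ℛ k h).right i)).right j = 1 ⊗ₜ h := by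
  have := sum_coassoc ((LinearMap.mul' k H ∘ₗ (antipode k).lTensor H).rTensor H ∘ₗ
    (TensorProduct.assoc k H H H).symm.toLinearMap) h
  simp only [LinearMap.comp_apply, LinearEquiv.coe_coe, TensorProduct.assoc_symm_tmul,
    LinearMap.rTensor_tmul, LinearMap.lTensor_tmul, LinearMap.mul'_apply] at this
  rw [← this]
  simp_rw [← TensorProduct.sum_tmul, sum_mul_antipode_eq_smul, TensorProduct.smul_tmul,
    ← TensorProduct.tmul_sum, sum_counit_smul_right]

/-- Both sides are convolution inverses of Δ in Hom(H, H ⊗ H). -/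
theorem comul_antipode (h : H) :
    (comul (antipode k h) : H ⊗[k] H) =
      TensorProduct.map (antipode k) (antipode k) (TensorProduct.comm k H H (comul h)) := by
  have key : WithConv.toConv (TensorProduct.map (antipode k) (antipode k) ∘ₗ
      (TensorProduct.comm k H H).toLinearMap ∘ₗ (comul : H →ₗ[k] H ⊗[k] H)) =
      WithConv.toConv ((comul : H →ₗ[k] H ⊗[k] H) ∘ₗ antipode k) := by
    refine left_inv_eq_right_inv (a := WithConv.toConv (comul : H →ₗ[k] H ⊗[k] H)) ?_
      LinearMap.comul_right_inv
    ext h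
    rw [(ℛ k h).convMul_apply]
    have := sum_coassoc (LinearMap.mul' k (H ⊗[k] H) ∘ₗ TensorProduct.map
      ((TensorProduct.mk k H H 1) ∘ₗ antipode k)
      (LinearMap.mul' k (H ⊗[k] H) ∘ₗ TensorProduct.map
      ((TensorProduct.mk k H H).flip 1 ∘ₗ antipode k) comul)) h
    simp only [LinearMap.comp_apply, TensorProduct.map_tmul, LinearMap.mul'_apply,
      TensorProduct.mk_apply, LinearMap.flip_apply] at this
    simp only [LinearMap.comp_apply, LinearEquiv.coe_coe]
    simp_rw [comul_eq_sum ((ℛ k h).left _), map_sum, TensorProduct.comm_tmul,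
      TensorProduct.map_tmul, Finset.sum_mul]
    simp_rw [← Finset.mul_sum, sum_antipode_tmul_one_mul_comul,
      Algebra.TensorProduct.tmul_mul_tmul, one_mul] at this
    simp_rw [← mul_assoc, Algebra.TensorProduct.tmul_mul_tmul, one_mul, mul_one] at this
    rw [this, ← TensorProduct.tmul_sum, sum_antipode_mul_eq_smul]
    simp [Algebra.TensorProduct.one_def, Algebra.algebraMap_eq_smul_one]
  exact congr($(key).ofConv h).symm

end Sweedler

/-! ### Integrals, cointegrals and unimodularity -/

section Integral

variable {k H : Type*} [Field k] [Ring H] [HopfAlgebra k H]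

variable (k H) in
/-- The contraction `x ⊗ y ↦ f x • y`. -/
noncomputable def slice (f : Module.Dual k H) : H ⊗[k] H →ₗ[k] H :=
  (TensorProduct.lid k H).toLinearMap ∘ₗ TensorProduct.map f LinearMap.id

@[simp] theorem slice_tmul (f : Module.Dual k H) (x y : H) :
    slice k H f (x ⊗ₜ y) = f x • y := by simp [slice]

theorem slice_mul_one_tmul (f : Module.Dual k H) (t : H ⊗[k] H) (y : H) :
    slice k H f (t * (1 ⊗ₜ y)) = slice k H f t * y := by
  induction t with
  | zero => simp
  | tmul a b => simp
  | add a b ha hb => simp [add_mul, ha, hb]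

theorem slice_one_tmul_mul (f : Module.Dual k H) (t : H ⊗[k] H) (y : H) :
    slice k H f ((1 ⊗ₜ y) * t) = y * slice k H f t := by
  induction t with
  | zero => simp
  | tmul a b => simp
  | add a b ha hb => simp [mul_add, ha, hb]

variable {lam : Module.Dual k H} {Λ : H}

theorem IsRightCointegral.slice_comul (hlam : IsRightCointegral lam) (h : H) :
    slice k H lam (comul h) = lam h • 1 := hlam h

/-- Write y ⊗ 1 = Δ(y₁)(1 ⊗ S(y₂)); then λ meets Δ(x y₁), where the cointegral property applies. -/
theorem IsRightCointegral.slice_comul_mul (hlam : IsRightCointegral lam) (x y : H) :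
    slice k H lam (comul x * (y ⊗ₜ 1)) =
      ∑ j ∈ (ℛ k y).index, lam (x * (ℛ k y).left j) • antipode k ((ℛ k y).right j) := by
  rw [← sum_comul_mul_one_tmul_antipode, Finset.mul_sum, map_sum]
  refine Finset.sum_congr rfl fun j _ => ?_
  rw [← mul_assoc, ← Bialgebra.comul_mul, slice_mul_one_tmul, hlam.slice_comul, smul_mul_assoc,
    one_mul]

theorem IsRightCointegral.sum_smul_antipode (hlam : IsRightCointegral lam)
    (hΛ : IsLeftIntegral k Λ) (hnorm : lam Λ = 1) (x : H) :
    ∑ j ∈ (ℛ k Λ).index, lam (x * (ℛ k Λ).left j) • antipode k ((ℛ k Λ).right j) = x := by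
  rw [← hlam.slice_comul_mul, comul_eq_sum, Finset.sum_mul, map_sum]
  simp only [Algebra.TensorProduct.tmul_mul_tmul, mul_one, slice_tmul, hΛ _, map_smul, hnorm,
    smul_eq_mul]
  exact sum_counit_smul_right x

variable [FiniteDimensional k H]

omit [FiniteDimensional k H] in
theorem IsRightCointegral.antipode_surjective (hlam : IsRightCointegral lam)
    (hΛ : IsLeftIntegral k Λ) (hnorm : lam Λ = 1) :
    Function.Surjective (antipode k : H →ₗ[k] H) := fun x =>
  ⟨∑ j ∈ (ℛ k Λ).index, lam (x * (ℛ k Λ).left j) • (ℛ k Λ).right j, by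
    simpa only [map_sum, map_smul] using hlam.sum_smul_antipode hΛ hnorm x⟩

theorem IsRightCointegral.antipode_injective (hlam : IsRightCointegral lam)
    (hΛ : IsLeftIntegral k Λ) (hnorm : lam Λ = 1) :
    Function.Injective (antipode k : H →ₗ[k] H) :=
  LinearMap.injective_iff_surjective.mpr (hlam.antipode_surjective hΛ hnorm)

theorem isUnit_antipode (hS : Function.Injective (antipode k : H →ₗ[k] H)) :
    IsUnit (antipode k : Module.End k H) :=
  (LinearMap.isUnit_iff_ker_eq_bot _).mpr (LinearMap.ker_eq_bot.mpr hS)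

theorem antipode_antipodeInv (hS : Function.Injective (antipode k : H →ₗ[k] H)) (h : H) :
    antipode k (antipodeInv k H h) = h :=
  congr($(Ring.mul_inverse_cancel _ (isUnit_antipode hS)) h)

theorem antipodeInv_antipode (hS : Function.Injective (antipode k : H →ₗ[k] H)) (h : H) :
    antipodeInv k H (antipode k h) = h :=
  congr($(Ring.inverse_mul_cancel _ (isUnit_antipode hS)) h)

/-- `sum_smul_antipode` recovers c from the functional λ(c ·), so c ↦ λ(c ·) is injective, hence
bijective by dimension. -/
theorem IsRightCointegral.exists_eq_mul (hlam : IsRightCointegral lam)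
    (hΛ : IsLeftIntegral k Λ) (hnorm : lam Λ = 1) (f : Module.Dual k H) :
    ∃ c, ∀ x, f x = lam (c * x) := by
  have hinj : Function.Injective ((LinearMap.mul k H).compr₂ lam) := by
    rw [injective_iff_map_eq_zero]
    intro x hx
    rw [← hlam.sum_smul_antipode hΛ hnorm x]
    exact Finset.sum_eq_zero fun j _ => by
      rw [show lam (x * (ℛ k Λ).left j) = 0 from congr($hx _), zero_smul]
  obtain ⟨c, hc⟩ := (LinearMap.injective_iff_surjective_of_finrank_eq_finrank
    (Subspace.dual_finrank_eq (K := k) (V := H)).symm).mp hinj f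
  exact ⟨c, fun x => congr($hc.symm x)⟩

theorem IsRightCointegral.eq_of_forall_mul (hlam : IsRightCointegral lam)
    (hΛ : IsLeftIntegral k Λ) (hnorm : lam Λ = 1) {y z : H}
    (h : ∀ x, lam (x * y) = lam (x * z)) : y = z := by
  refine (Module.forall_dual_apply_eq_zero_iff k (y - z)).mp ?_ |> sub_eq_zero.mp
  intro f
  obtain ⟨c, hc⟩ := hlam.exists_eq_mul hΛ hnorm f
  rw [hc, mul_sub, map_sub, h, sub_self]

theorem IsRightCointegral.sum_antipode_mul_smul (hlam : IsRightCointegral lam)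
    (hΛ : IsLeftIntegral k Λ) (hnorm : lam Λ = 1) (y : H) :
    ∑ j ∈ (ℛ k Λ).index, lam (antipode k ((ℛ k Λ).right j) * y) • (ℛ k Λ).left j = y := by
  refine hlam.eq_of_forall_mul hΛ hnorm fun x => ?_
  conv_rhs => rw [← hlam.sum_smul_antipode hΛ hnorm x]
  simp only [Finset.mul_sum, Finset.sum_mul, map_sum, mul_smul_comm, smul_mul_assoc, map_smul,
    smul_eq_mul, mul_comm]

/-- Expanding h Λ₁ on one side and S(Λ₂) h on the other in the dual bases gives the same double sum.
-/
theorem IsRightCointegral.casimir_comm (hlam : IsRightCointegral lam)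
    (hΛ : IsLeftIntegral k Λ) (hnorm : lam Λ = 1) (h : H) :
    ∑ j ∈ (ℛ k Λ).index, (h * (ℛ k Λ).left j) ⊗ₜ[k] antipode k ((ℛ k Λ).right j) =
      ∑ j ∈ (ℛ k Λ).index, (ℛ k Λ).left j ⊗ₜ[k] (antipode k ((ℛ k Λ).right j) * h) := by
  have key : ∀ x, (∑ i ∈ (ℛ k Λ).index, ∑ j ∈ (ℛ k Λ).index,
      (lam (antipode k ((ℛ k Λ).right i) * (x * (ℛ k Λ).left j)) • (ℛ k Λ).left i) ⊗ₜ[k]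
        antipode k ((ℛ k Λ).right j)) =
      ∑ i ∈ (ℛ k Λ).index, (ℛ k Λ).left i ⊗ₜ[k] (antipode k ((ℛ k Λ).right i) * x) := by
    intro x
    refine Finset.sum_congr rfl fun i _ => ?_
    simp_rw [TensorProduct.smul_tmul, ← TensorProduct.tmul_sum, ← mul_assoc,
      hlam.sum_smul_antipode hΛ hnorm]
  rw [← key h, Finset.sum_comm]
  simp_rw [← TensorProduct.sum_tmul, hlam.sum_antipode_mul_smul hΛ hnorm]

theorem IsRightCointegral.eq_smul_of_isLeftIntegral (hlam : IsRightCointegral lam)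
    (hΛ : IsLeftIntegral k Λ) (hnorm : lam Λ = 1) {e : H} (he : IsLeftIntegral k e) :
    e = lam e • Λ := by
  refine hlam.eq_of_forall_mul hΛ hnorm fun x => ?_
  rw [he x, mul_smul_comm, hΛ x, map_smul, map_smul, map_smul, hnorm, smul_eq_mul, smul_eq_mul,
    smul_eq_mul, mul_one, mul_comm]

/-- The modular function `h ↦ lam (Λ h)`, so that `Λ h = lam (Λ h) Λ`, as an algebra map. -/
noncomputable def IsRightCointegral.modular (hlam : IsRightCointegral lam)
    (hΛ : IsLeftIntegral k Λ) (hnorm : lam Λ = 1) : H →ₐ[k] k :=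
  AlgHom.ofLinearMap (lam ∘ₗ LinearMap.mulLeft k Λ) (by simp [hnorm]) fun x y => by
    have h : Λ * x = lam (Λ * x) • Λ := hlam.eq_smul_of_isLeftIntegral hΛ hnorm fun h => by
      rw [← mul_assoc, hΛ, smul_mul_assoc]
    simp only [LinearMap.comp_apply, LinearMap.mulLeft_apply]
    rw [← mul_assoc, h, smul_mul_assoc, map_smul, map_smul, hnorm, smul_eq_mul, smul_eq_mul,
      mul_one]

theorem IsRightCointegral.mul_eq_modular_smul (hlam : IsRightCointegral lam)
    (hΛ : IsLeftIntegral k Λ) (hnorm : lam Λ = 1) (h : H) :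
    Λ * h = hlam.modular hΛ hnorm h • Λ :=
  hlam.eq_smul_of_isLeftIntegral hΛ hnorm fun g => by
    rw [← mul_assoc, hΛ, smul_mul_assoc]

/-- Let χ be the modular character. `slice_comul_mul` at Λ and v reads λ(Λ₁ v) Λ₂ = χ(v₁) S(v₂).
Since v is central, S maps the left side to v = S²(v), and S² is injective. -/
theorem IsRightCointegral.slice_modular_comul (hlam : IsRightCointegral lam)
    (hΛ : IsLeftIntegral k Λ) (hnorm : lam Λ = 1) {v : H} (hv : ∀ h, v * h = h * v)
    (hSv : antipode k v = v) :
    slice k H (hlam.modular hΛ hnorm).toLinearMap (comul v) = v := by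
  refine hlam.antipode_injective hΛ hnorm (hlam.antipode_injective hΛ hnorm ?_)
  have h1 := hlam.slice_comul_mul Λ v
  simp_rw [hlam.mul_eq_modular_smul hΛ hnorm, map_smul, hnorm, smul_eq_mul, mul_one] at h1
  have h2 := hlam.sum_smul_antipode hΛ hnorm v
  have h3 : antipode k (slice k H lam (comul Λ * (v ⊗ₜ[k] 1))) = v := by
    rw [comul_eq_sum, Finset.sum_mul, map_sum, map_sum]
    simpa only [Algebra.TensorProduct.tmul_mul_tmul, mul_one, slice_tmul, map_smul, ← hv] using h2
  rw [hSv, hSv, comul_eq_sum v, map_sum]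
  rw [h1, map_sum] at h3
  simpa only [slice_tmul, map_sum, map_smul, AlgHom.toLinearMap_apply] using h3

omit [FiniteDimensional k H] in
theorem slice_algHom_mul (χ : H →ₐ[k] k) (s t : H ⊗[k] H) :
    slice k H χ.toLinearMap (s * t) =
      slice k H χ.toLinearMap s * slice k H χ.toLinearMap t := by
  induction s with
  | zero => simp
  | add a b ha hb => simp only [add_mul, map_add, ha, hb]
  | tmul a b =>
    induction t with
    | zero => simp
    | add a b ha hb => simp only [mul_add, map_add, ha, hb]
    | tmul c d => simp [smul_smul, mul_comm]

omit [FiniteDimensional k H] in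
theorem IsRMatrix.isUnit_monodromy {R : H ⊗[k] H} (hR : IsRMatrix R) : IsUnit (monodromy R) :=
  (hR.isUnit.map (Algebra.TensorProduct.comm k H H)).mul hR.isUnit

omit [FiniteDimensional k H] in
theorem IsRibbonElement.comul_mul_monodromy {R : H ⊗[k] H} {v : H} (hv : IsRibbonElement R v)
    (hR : IsRMatrix R) : comul v * monodromy R = v ⊗ₜ[k] v := by
  rw [hv.comul_eq, mul_assoc, Ring.inverse_mul_cancel _ hR.isUnit_monodromy, mul_one]

omit [FiniteDimensional k H] in
-- As χ is multiplicative, χ ⊗ id turns Δ(v) Q = v ⊗ v into v · (χ ⊗ id)(Q) = χ(v) v, and v cancels.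
theorem IsRibbonElement.slice_monodromy {R : H ⊗[k] H} {v : H} (hv : IsRibbonElement R v)
    (hR : IsRMatrix R) {χ : H →ₐ[k] k} (h1 : slice k H χ.toLinearMap (comul v) = v)
    (h2 : χ v = 1) : slice k H χ.toLinearMap (monodromy R) = 1 := by
  have := congrArg (slice k H χ.toLinearMap) (hv.comul_mul_monodromy hR)
  rw [slice_algHom_mul, h1, slice_tmul, AlgHom.toLinearMap_apply, h2, one_smul] at this
  exact hv.isUnit.mul_left_cancel (by rw [this, mul_one])

omit [FiniteDimensional k H] in
theorem IsFactorizable.slice_injective {R : H ⊗[k] H} (hR : IsFactorizable R)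
    {f g : Module.Dual k H}
    (h : slice k H f (monodromy R) = slice k H g (monodromy R)) : f = g := by
  obtain ⟨b, c, hbc⟩ := hR
  simp only [hbc, map_sum, slice_tmul] at h
  refine b.ext fun l => ?_
  rw [← sub_eq_zero, ← Finset.sum_sub_distrib] at h
  simp_rw [← sub_smul] at h
  exact sub_eq_zero.mp (Fintype.linearIndependent_iff.mp c.linearIndependent _ h l)

theorem IsFactorizable.exists_slice_eq {R : H ⊗[k] H} (hR : IsFactorizable R) (h : H) :
    ∃ f, slice k H f (monodromy R) = h := by
  let F : Module.Dual k H →ₗ[k] H :=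
    { toFun := fun f => slice k H f (monodromy R)
      map_add' := fun f g => by simp [slice, TensorProduct.map_add_left]
      map_smul' := fun c f => by simp [slice, TensorProduct.map_smul_left] }
  exact (LinearMap.injective_iff_surjective_of_finrank_eq_finrank
    (Subspace.dual_finrank_eq (K := k) (V := H)) (f := F)).mp (fun f g h => hR.slice_injective h) h

theorem IsRightCointegral.unimodular {R : H ⊗[k] H} {v : H} (hR : IsRMatrix R)
    (hv : IsRibbonElement R v) (hfact : IsFactorizable R) (hlam : IsRightCointegral lam)
    (hΛ : IsLeftIntegral k Λ) (hnorm : lam Λ = 1) (h : H) :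
    Λ * h = counit (R := k) h • Λ := by
  have h1 : slice k H (hlam.modular hΛ hnorm).toLinearMap (monodromy R) = 1 := by
    refine hv.slice_monodromy hR (hlam.slice_modular_comul hΛ hnorm hv.central hv.antipode_eq) ?_
    change lam (Λ * v) = 1
    rw [← hv.central, hΛ, hv.counit_eq, one_smul, hnorm]
  have h2 : slice k H (Bialgebra.counitAlgHom k H).toLinearMap (monodromy R) = 1 := by
    refine hv.slice_monodromy hR ?_ hv.counit_eq
    rw [comul_eq_sum, map_sum]
    simp only [slice_tmul]
    exact sum_counit_smul_right v
  rw [hlam.mul_eq_modular_smul hΛ hnorm]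
  exact congr($(hfact.slice_injective (h1.trans h2.symm)) h • Λ)

/-- The Nakayama automorphism of `lam` is the square of the antipode if `Λ` is two-sided. -/
theorem IsRightCointegral.apply_mul_comm (hlam : IsRightCointegral lam)
    (hΛ : IsLeftIntegral k Λ) (hnorm : lam Λ = 1)
    (hΛr : ∀ h, Λ * h = counit (R := k) h • Λ) (a b : H) :
    lam (a * b) = lam (antipode k (antipode k b) * a) := by
  obtain ⟨c, hc⟩ := hlam.exists_eq_mul hΛ hnorm (lam ∘ₗ LinearMap.mulRight k b)
  simp only [LinearMap.comp_apply, LinearMap.mulRight_apply] at hc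
  have h1 := hlam.sum_smul_antipode hΛ hnorm c
  simp_rw [← hc] at h1
  -- Here Λ b₁ = ε(b₁) Λ because Λ is two-sided. Applying S afterwards identifies c with S²(b).
  have h2 : slice k H lam (comul Λ * (b ⊗ₜ[k] 1)) = antipode k b := by
    rw [hlam.slice_comul_mul]
    simp_rw [hΛr, map_smul, hnorm, smul_eq_mul, mul_one, ← map_smul]
    rw [← map_sum, sum_counit_smul_right]
  rw [comul_eq_sum, Finset.sum_mul, map_sum] at h2
  simp only [Algebra.TensorProduct.tmul_mul_tmul, mul_one, slice_tmul] at h2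
  rw [hc, ← h1, ← h2, map_sum]
  simp only [map_smul]

/-- Moving h₂ to the front by the Nakayama automorphism produces S²(h₂) S(h₁) = S(h₁ S(h₂)), which
collapses. -/
theorem IsRightCointegral.sum_smul_adjoint (hlam : IsRightCointegral lam)
    (hΛ : IsLeftIntegral k Λ) (hnorm : lam Λ = 1)
    (hΛr : ∀ h, Λ * h = counit (R := k) h • Λ) (w h : H) :
    ∑ i ∈ (ℛ k h).index, slice k H lam
      (((antipode k ((ℛ k h).left i) * w) ⊗ₜ 1) * comul ((ℛ k h).right i)) = lam w • h := by
  have := congrArg (slice k H (lam ∘ₗ LinearMap.mulRight k w ∘ₗ antipode k))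
    (sum_mul_antipode_tmul (k := k) h)
  simp only [map_sum, slice_tmul, LinearMap.comp_apply, LinearMap.mulRight_apply, antipode_one,
    one_mul, antipode_mul_antidistrib] at this
  rw [← this]
  refine Finset.sum_congr rfl fun i _ => ?_
  rw [comul_eq_sum, Finset.mul_sum, map_sum]
  refine Finset.sum_congr rfl fun j _ => ?_
  rw [Algebra.TensorProduct.tmul_mul_tmul, slice_tmul, one_mul,
    hlam.apply_mul_comm hΛ hnorm hΛr, mul_assoc]

theorem IsRightCointegral.sum_slice_adjoint (hlam : IsRightCointegral lam)
    (hΛ : IsLeftIntegral k Λ) (hnorm : lam Λ = 1)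
    (hΛr : ∀ h, Λ * h = counit (R := k) h • Λ) (t : H ⊗[k] H) (h : H) :
    ∑ i ∈ (ℛ k h).index, slice k H lam
      ((antipode k ((ℛ k h).left i) ⊗ₜ 1) * t * comul ((ℛ k h).right i)) =
      slice k H lam t * h := by
  induction t with
  | zero => simp
  | add a b ha hb => simp only [mul_add, add_mul, map_add, Finset.sum_add_distrib, ha, hb]
  | tmul x y =>
    rw [slice_tmul, smul_mul_assoc, ← mul_smul_comm, ← hlam.sum_smul_adjoint hΛ hnorm hΛr,
      Finset.mul_sum]
    refine Finset.sum_congr rfl fun i _ => ?_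
    rw [← slice_one_tmul_mul, ← mul_assoc, Algebra.TensorProduct.tmul_mul_tmul,
      Algebra.TensorProduct.tmul_mul_tmul, one_mul, one_mul, mul_one]

end Integral

/-! ### The product on `H` dual to Δ_F -/

section PreComul

variable {k H : Type*} [Field k] [Ring H] [HopfAlgebra k H]
  {lam : Module.Dual k H} {Λ : H}

theorem preComul_tmul (lam : Module.Dual k H) (x y : H) :
    preComul lam (x ⊗ₜ y) =
      ∑ i ∈ (ℛ k x).index, lam (antipode k ((ℛ k x).right i) * y) • (ℛ k x).left i := by
  simp only [preComul, LinearMap.comp_apply, LinearMap.rTensor_tmul, comul_eq_sum,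
    TensorProduct.sum_tmul, map_sum, LinearEquiv.coe_coe, TensorProduct.assoc_tmul,
    LinearMap.lTensor_tmul, LinearMap.mul'_apply, TensorProduct.rid_tmul]

/-- Since S reverses Δ, applying S to both sides gives `slice_comul_mul` at S(x) and y. -/
theorem IsRightCointegral.preComul_tmul_eq_slice (hlam : IsRightCointegral lam)
    (hS : Function.Injective (antipode k : H →ₗ[k] H)) (x y : H) :
    preComul lam (x ⊗ₜ y) = slice k H lam ((antipode k x ⊗ₜ 1) * comul y) := by
  apply hS
  have := hlam.slice_comul_mul (antipode k x) y
  rw [comul_antipode, comul_eq_sum x] at this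
  simp only [map_sum, TensorProduct.comm_tmul, TensorProduct.map_tmul, Finset.sum_mul,
    Algebra.TensorProduct.tmul_mul_tmul, mul_one, slice_tmul] at this
  rw [preComul_tmul, comul_eq_sum y]
  simpa only [Finset.mul_sum, Algebra.TensorProduct.tmul_mul_tmul, one_mul, map_sum, slice_tmul,
    map_smul] using this

/-- Left colinearity, immediate from the first formula for μ; it becomes `frobenius_right`. -/
theorem comul_preComul_tmul (lam : Module.Dual k H) (x y : H) :
    comul (R := k) (preComul lam (x ⊗ₜ y)) =
      ∑ i ∈ (ℛ k x).index, (ℛ k x).left i ⊗ₜ preComul lam ((ℛ k x).right i ⊗ₜ y) := by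
  have := sum_coassoc (((TensorProduct.rid k H).toLinearMap ∘ₗ
    (lam ∘ₗ LinearMap.mulRight k y ∘ₗ antipode k).lTensor H).lTensor H) x
  simp only [LinearMap.lTensor_tmul, LinearMap.comp_apply, LinearMap.mulRight_apply,
    LinearEquiv.coe_coe, TensorProduct.rid_tmul] at this
  simp_rw [preComul_tmul, TensorProduct.tmul_sum]
  rw [← this]
  simp_rw [map_sum, map_smul, TensorProduct.tmul_smul, ← Finset.smul_sum, ← comul_eq_sum]

/-- Right colinearity, from the second formula for μ; it becomes `frobenius_left`, as the nested
pairing exchanges the sides. -/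
theorem IsRightCointegral.comul_preComul_tmul (hlam : IsRightCointegral lam)
    (hS : Function.Injective (antipode k : H →ₗ[k] H)) (x y : H) :
    comul (R := k) (preComul lam (x ⊗ₜ y)) =
      ∑ j ∈ (ℛ k y).index, preComul lam (x ⊗ₜ (ℛ k y).left j) ⊗ₜ (ℛ k y).right j := by
  have := sum_coassoc ((TensorProduct.lid k (H ⊗[k] H)).toLinearMap ∘ₗ
    (lam ∘ₗ LinearMap.mulLeft k (antipode k x)).rTensor (H ⊗[k] H)) y
  simp only [LinearMap.rTensor_tmul, LinearMap.comp_apply, LinearMap.mulLeft_apply,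
    LinearEquiv.coe_coe, TensorProduct.lid_tmul] at this
  simp_rw [hlam.preComul_tmul_eq_slice hS, comul_eq_sum ((ℛ k y).left _), Finset.mul_sum,
    map_sum, Algebra.TensorProduct.tmul_mul_tmul, one_mul, slice_tmul, TensorProduct.sum_tmul,
    ← TensorProduct.smul_tmul']
  rw [this]
  simp_rw [← Finset.smul_sum, ← comul_eq_sum]
  rw [comul_eq_sum y, Finset.mul_sum, map_sum, map_sum]
  simp_rw [Algebra.TensorProduct.tmul_mul_tmul, one_mul, slice_tmul, map_smul]

theorem IsRightCointegral.preComul_assoc (hlam : IsRightCointegral lam)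
    (hS : Function.Injective (antipode k : H →ₗ[k] H)) (x y z : H) :
    preComul lam (x ⊗ₜ preComul lam (y ⊗ₜ z)) = preComul lam (preComul lam (x ⊗ₜ y) ⊗ₜ z) := by
  have := congrArg ((TensorProduct.rid k H).toLinearMap ∘ₗ
    (lam ∘ₗ LinearMap.mulRight k z ∘ₗ antipode k).lTensor H)
    ((comul_eq_sum (preComul lam (x ⊗ₜ y))).symm.trans (hlam.comul_preComul_tmul hS x y))
  simp only [map_sum, LinearMap.lTensor_tmul, LinearMap.comp_apply, LinearMap.mulRight_apply,
    LinearEquiv.coe_coe, TensorProduct.rid_tmul] at this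
  rw [preComul_tmul lam y, preComul_tmul lam _ z, this]
  simp only [TensorProduct.tmul_sum, TensorProduct.tmul_smul, map_sum, map_smul]

theorem preComul_comul (lam : Module.Dual k H) (x : H) :
    preComul lam (comul x) = lam 1 • x := by
  have := sum_coassoc (((LinearMap.mul' k H ∘ₗ (antipode k).rTensor H)).lTensor H) x
  simp only [LinearMap.lTensor_tmul, LinearMap.rTensor_tmul, LinearMap.comp_apply,
    LinearMap.mul'_apply] at this
  simp_rw [← TensorProduct.tmul_sum, sum_antipode_mul_eq_smul, ← TensorProduct.smul_tmul,
    ← TensorProduct.sum_tmul, sum_counit_smul_left] at this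
  have := congrArg ((TensorProduct.rid k H).toLinearMap ∘ₗ lam.lTensor H) this
  simp only [map_sum, LinearMap.lTensor_tmul, LinearMap.comp_apply, LinearEquiv.coe_coe,
    TensorProduct.rid_tmul] at this
  rw [comul_eq_sum x, map_sum, ← this]
  exact Finset.sum_congr rfl fun i _ => preComul_tmul ..

theorem preComul_integral_right (hΛ : IsLeftIntegral k Λ) (hnorm : lam Λ = 1) (x : H) :
    preComul lam (x ⊗ₜ Λ) = x := by
  simp_rw [preComul_tmul, hΛ _, map_smul, hnorm, counit_antipode, smul_eq_mul, mul_one]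
  exact sum_counit_smul_left x

theorem IsRightCointegral.preComul_integral_left [FiniteDimensional k H]
    (hlam : IsRightCointegral lam)
    (hΛ : IsLeftIntegral k Λ) (hnorm : lam Λ = 1) (y : H) :
    preComul lam (Λ ⊗ₜ y) = y := by
  rw [preComul_tmul, hlam.sum_antipode_mul_smul hΛ hnorm]

/-- In the second formula, S(h₁) from the first argument meets h₂ from the second and cancels,
leaving h outside λ. -/
theorem IsRightCointegral.preComul_comul_mul (hlam : IsRightCointegral lam)
    (hS : Function.Injective (antipode k : H →ₗ[k] H)) (h : H) (t : H ⊗[k] H) :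
    preComul lam (comul h * t) = h * preComul lam t := by
  induction t with
  | zero => simp
  | add a b ha hb => simp only [mul_add, map_add, ha, hb]
  | tmul x y =>
    have := congrArg (fun s => slice k H lam ((antipode k x ⊗ₜ 1) * s * comul y))
      (sum_antipode_tmul_one_mul_comul (k := k) h)
    have comm : (antipode k x ⊗ₜ[k] (1 : H)) * (1 ⊗ₜ h) = (1 ⊗ₜ h) * (antipode k x ⊗ₜ 1) := by
      simp
    rw [comm, mul_assoc (1 ⊗ₜ h), slice_one_tmul_mul, ← hlam.preComul_tmul_eq_slice hS] at this
    rw [← this, comul_eq_sum, Finset.sum_mul, map_sum, Finset.mul_sum, Finset.sum_mul, map_sum]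
    refine Finset.sum_congr rfl fun i _ => ?_
    rw [Algebra.TensorProduct.tmul_mul_tmul, hlam.preComul_tmul_eq_slice hS,
      antipode_mul_antidistrib, Bialgebra.comul_mul, ← mul_assoc, ← mul_assoc,
      Algebra.TensorProduct.tmul_mul_tmul, one_mul]

/-- Here S(h₁) and h₂ lie at opposite ends inside λ, so adjoint invariance of λ is needed, and with
it a two-sided Λ. -/
theorem IsRightCointegral.preComul_mul_comul [FiniteDimensional k H]
    (hlam : IsRightCointegral lam)
    (hΛ : IsLeftIntegral k Λ) (hnorm : lam Λ = 1)
    (hΛr : ∀ h, Λ * h = counit (R := k) h • Λ) (h : H) (t : H ⊗[k] H) :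
    preComul lam (t * comul h) = preComul lam t * h := by
  have hS := hlam.antipode_injective hΛ hnorm
  induction t with
  | zero => simp
  | add a b ha hb => simp only [add_mul, map_add, ha, hb]
  | tmul x y =>
    rw [hlam.preComul_tmul_eq_slice hS, ← hlam.sum_slice_adjoint hΛ hnorm hΛr, comul_eq_sum h,
      Finset.mul_sum, map_sum]
    refine Finset.sum_congr rfl fun i _ => ?_
    rw [Algebra.TensorProduct.tmul_mul_tmul, hlam.preComul_tmul_eq_slice hS,
      antipode_mul_antidistrib, Bialgebra.comul_mul, ← mul_assoc, ← mul_assoc,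
      Algebra.TensorProduct.tmul_mul_tmul, one_mul]

end PreComul

/-! ### The Drinfeld image of λ, and semisimplicity -/

section Semisimple

variable {k H : Type*} [Field k] [Ring H] [HopfAlgebra k H]
  {lam : Module.Dual k H} {Λ : H}

/-- Q = Δ(v)⁻¹ (v ⊗ v) with v central. -/
theorem IsRibbonElement.commute_monodromy {R : H ⊗[k] H} {v : H} (hv : IsRibbonElement R v)
    (hR : IsRMatrix R) (h : H) : monodromy R * comul h = comul h * monodromy R := by
  have hu : IsUnit (comul v : H ⊗[k] H) := hv.isUnit.map (Bialgebra.comulAlgHom k H)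
  have hvv : ∀ t : H ⊗[k] H, (v ⊗ₜ[k] v) * t = t * (v ⊗ₜ[k] v) := fun t => by
    induction t with
    | zero => simp
    | add a b ha hb => simp only [mul_add, add_mul, ha, hb]
    | tmul a b => simp only [Algebra.TensorProduct.tmul_mul_tmul, hv.central]
  refine hu.mul_left_cancel ?_
  rw [← mul_assoc, hv.comul_mul_monodromy hR, ← mul_assoc, ← Bialgebra.comul_mul, hv.central,
    Bialgebra.comul_mul, mul_assoc, hv.comul_mul_monodromy hR, hvv]

/-- The opposite coproduct applied to the first leg of `R₂₁`. -/
theorem IsRMatrix.comul_left_comm {R : H ⊗[k] H} (hR : IsRMatrix R) {ι : Type*} (s : Finset ι)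
    (a b : ι → H) (h : R = ∑ i ∈ s, a i ⊗ₜ b i) :
    ∑ i ∈ s, comul (R := k) (b i) ⊗ₜ[k] a i = ∑ i ∈ s, ∑ j ∈ s, (b j ⊗ₜ b i) ⊗ₜ (a i * a j) := by
  have := congrArg (TensorProduct.comm k H (H ⊗[k] H)) hR.comul_right
  rw [h] at this
  simpa only [map_sum, TensorProduct.map_tmul, LinearMap.id_apply, TensorProduct.comm_tmul,
    leg13, leg12, TensorProduct.mk_apply, LinearMap.flip_apply, Finset.sum_mul_sum,
    Algebra.TensorProduct.tmul_mul_tmul, one_mul, mul_one] using this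

theorem IsRMatrix.comul_left_sum {R : H ⊗[k] H} (hR : IsRMatrix R) {ι : Type*} (s : Finset ι)
    (a b : ι → H) (h : R = ∑ i ∈ s, a i ⊗ₜ b i) :
    ∑ i ∈ s, comul (R := k) (a i) ⊗ₜ[k] b i = ∑ i ∈ s, ∑ j ∈ s, (a i ⊗ₜ a j) ⊗ₜ (b i * b j) := by
  have := congrArg (TensorProduct.assoc k H H H).symm hR.comul_left
  rw [h, LinearEquiv.symm_apply_apply] at this
  simpa only [map_sum, TensorProduct.map_tmul, LinearMap.id_apply, TensorProduct.assoc_symm_tmul,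
    leg13, leg23, TensorProduct.mk_apply, TensorProduct.tmul_sum, Finset.sum_mul_sum,
    Algebra.TensorProduct.tmul_mul_tmul, one_mul, mul_one] using this

variable [FiniteDimensional k H] {R : H ⊗[k] H} {v : H}

theorem IsRightCointegral.slice_monodromy_comm (hR : IsRMatrix R) (hv : IsRibbonElement R v)
    (hlam : IsRightCointegral lam) (hΛ : IsLeftIntegral k Λ) (hnorm : lam Λ = 1)
    (hΛr : ∀ h, Λ * h = counit (R := k) h • Λ) (h : H) :
    h * slice k H lam (monodromy R) = slice k H lam (monodromy R) * h := by
  rw [← hlam.sum_slice_adjoint hΛ hnorm hΛr, ← slice_one_tmul_mul,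
    ← sum_antipode_tmul_one_mul_comul, Finset.sum_mul, map_sum]
  refine Finset.sum_congr rfl fun i _ => ?_
  rw [mul_assoc, mul_assoc, hv.commute_monodromy hR]

omit [FiniteDimensional k H] in
-- Apply λ to the first leg of (Δ ⊗ id)(Q). The cointegral property gives 1 ⊗ z. The hexagon
-- identities instead wrap one copy of Q around another; λ turns the inner one into z, which is
-- central and can be moved out, leaving Q (1 ⊗ z).
theorem IsRightCointegral.monodromy_mul_one_tmul (hR : IsRMatrix R)
    (hlam : IsRightCointegral lam)
    (hz : ∀ h, h * slice k H lam (monodromy R) = slice k H lam (monodromy R) * h) :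
    monodromy R * (1 ⊗ₜ slice k H lam (monodromy R)) = 1 ⊗ₜ slice k H lam (monodromy R) := by
  obtain ⟨s, hs⟩ := TensorProduct.exists_finset R
  have hQ : monodromy R = ∑ i ∈ s, ∑ j ∈ s, (i.2 * j.1) ⊗ₜ (i.1 * j.2) := by
    rw [monodromy, hs]
    simp only [map_sum, TensorProduct.comm_tmul, Finset.sum_mul_sum,
      Algebra.TensorProduct.tmul_mul_tmul]
  have hz' : slice k H lam (monodromy R) =
      ∑ i ∈ s, ∑ j ∈ s, lam (i.2 * j.1) • (i.1 * j.2) := by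
    simp only [hQ, map_sum, slice_tmul]
  generalize slice k H lam (monodromy R) = z at *
  have h1 : (slice k H lam).rTensor H
      ((∑ i ∈ s, comul (R := k) i.2 ⊗ₜ[k] i.1) * ∑ j ∈ s, comul (R := k) j.1 ⊗ₜ[k] j.2) =
      1 ⊗ₜ z := by
    simp only [Finset.sum_mul_sum, Algebra.TensorProduct.tmul_mul_tmul, map_sum,
      LinearMap.rTensor_tmul, ← Bialgebra.comul_mul, hlam.slice_comul, TensorProduct.smul_tmul,
      ← TensorProduct.tmul_sum, hz']
  rw [hR.comul_left_comm s _ _ hs, hR.comul_left_sum s _ _ hs] at h1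
  refine Eq.trans ?_ h1
  rw [hQ, Finset.sum_mul_sum, map_sum, Finset.sum_mul]
  refine Finset.sum_congr rfl fun i _ => ?_
  simp_rw [Finset.sum_mul_sum, map_sum, Finset.sum_mul]
  refine Eq.trans (Finset.sum_congr rfl fun l _ => ?_)
    (Finset.sum_comm.trans (Finset.sum_congr rfl fun m _ => Finset.sum_comm))
  rw [Algebra.TensorProduct.tmul_mul_tmul, mul_one, mul_assoc, hz, ← mul_assoc, hz',
    Finset.sum_comm]
  simp only [Finset.mul_sum, Finset.sum_mul, TensorProduct.tmul_sum, mul_smul_comm,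
    smul_mul_assoc, Algebra.TensorProduct.tmul_mul_tmul, LinearMap.rTensor_tmul, slice_tmul,
    TensorProduct.smul_tmul, mul_assoc]

omit [FiniteDimensional k H] in
theorem IsRibbonElement.counit_slice_monodromy (hR : IsRMatrix R)
    (hv : IsRibbonElement R v) (f : Module.Dual k H) :
    counit (R := k) (slice k H f (monodromy R)) = f 1 := by
  let E : H ⊗[k] H →ₐ[k] H := (Algebra.TensorProduct.rid k k H).toAlgHom.comp
    (Algebra.TensorProduct.map (AlgHom.id k H) (Bialgebra.counitAlgHom k H))
  have hE (x y : H) : E (x ⊗ₜ y) = counit (R := k) y • x := by simp [E]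
  have h1 : E (comul v) = v := by
    rw [comul_eq_sum, map_sum]
    simp only [hE, sum_counit_smul_left]
  have h2 : E (monodromy R) = 1 := by
    have := congrArg E (hv.comul_mul_monodromy hR)
    rw [map_mul, h1, hE, hv.counit_eq, one_smul] at this
    exact hv.isUnit.mul_left_cancel (by rw [this, mul_one])
  rw [← h2]
  generalize monodromy R = t
  induction t with
  | zero => simp
  | add a b ha hb => simp only [map_add, ha, hb]
  | tmul a b => simp [hE, mul_comm]

/-- By factorizability every h is some (f ⊗ id)(Q), so h z = f(1) z, and f(1) = ε(h). -/
theorem IsRightCointegral.slice_monodromy_isLeftIntegral (hR : IsRMatrix R)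
    (hv : IsRibbonElement R v) (hfact : IsFactorizable R)
    (hlam : IsRightCointegral lam)
    (hz : ∀ h, h * slice k H lam (monodromy R) = slice k H lam (monodromy R) * h) :
    IsLeftIntegral k (slice k H lam (monodromy R)) := by
  intro h
  obtain ⟨f, rfl⟩ := hfact.exists_slice_eq h
  rw [← slice_mul_one_tmul, hlam.monodromy_mul_one_tmul hR hz, slice_tmul,
    hv.counit_slice_monodromy hR]

theorem IsRightCointegral.apply_one_ne_zero (hR : IsRMatrix R) (hv : IsRibbonElement R v)
    (hfact : IsFactorizable R) (hlam : IsRightCointegral lam) (hΛ : IsLeftIntegral k Λ)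
    (hnorm : lam Λ = 1) (hε : counit (R := k) Λ ≠ 0) : lam 1 ≠ 0 := by
  intro h0
  have hΛr := hlam.unimodular hR hv hfact hΛ hnorm
  have hz := hlam.slice_monodromy_isLeftIntegral hR hv hfact
    (hlam.slice_monodromy_comm hR hv hΛ hnorm hΛr)
  have h1 := hlam.eq_smul_of_isLeftIntegral hΛ hnorm hz
  have h2 := hv.counit_slice_monodromy hR lam
  rw [h0, h1, map_smul, smul_eq_mul, mul_eq_zero, or_iff_left hε] at h2
  rw [h2, zero_smul] at h1
  have h3 : lam = 0 := hfact.slice_injective (h1.trans (by simp [slice]))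
  simp [h3] at hnorm

omit [FiniteDimensional k H] in
theorem exists_isLeftIntegral_of_isSemisimpleRing [IsSemisimpleRing H] :
    ∃ e : H, IsLeftIntegral k e ∧ counit (R := k) e = 1 := by
  let I : Ideal H := RingHom.ker (Bialgebra.counitAlgHom k H)
  have hI (x : H) : x ∈ I ↔ counit (R := k) x = 0 := Iff.rfl
  obtain ⟨J, hJ⟩ := exists_isCompl I
  obtain ⟨a, ha, e, he, hae⟩ :=
    Submodule.mem_sup.mp (hJ.sup_eq_top ▸ Submodule.mem_top (x := (1 : H)))
  have he1 : counit (R := k) e = 1 := by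
    rw [← Bialgebra.counit_one (R := k) (A := H), ← hae, map_add, (hI a).mp ha, zero_add]
  -- e is the component of 1 in a complement J of ker ε, and h e − ε(h) e lies in both summands.
  refine ⟨e, fun h => sub_eq_zero.mp ?_, he1⟩
  refine Submodule.disjoint_def.mp hJ.disjoint _ ?_ (J.sub_mem (J.smul_mem h he) ?_)
  · rw [hI, map_sub, Bialgebra.counit_mul, map_smul, he1, smul_eq_mul, sub_self]
  · rw [← algebraMap_smul H]
    exact J.smul_mem _ he

theorem IsRightCointegral.counit_ne_zero [IsSemisimpleRing H] (hlam : IsRightCointegral lam)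
    (hΛ : IsLeftIntegral k Λ) (hnorm : lam Λ = 1) : counit (R := k) Λ ≠ 0 := by
  obtain ⟨e, he, he1⟩ := exists_isLeftIntegral_of_isSemisimpleRing (k := k) (H := H)
  rw [hlam.eq_smul_of_isLeftIntegral hΛ hnorm he, map_smul, smul_eq_mul] at he1
  exact right_ne_zero_of_mul_eq_one he1

/-- Maschke's theorem for Hopf algebras. -/
theorem IsRightCointegral.isSemisimpleRing (hlam : IsRightCointegral lam)
    (hΛ : IsLeftIntegral k Λ) (hnorm : lam Λ = 1) (hε : counit (R := k) Λ ≠ 0) :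
    IsSemisimpleRing H := by
  refine (isSemisimpleModule_iff H H).mpr ⟨fun N => ?_⟩
  obtain ⟨π, hπ⟩ := (N.restrictScalars k).subtype.exists_leftInverse_of_injective
    (Submodule.ker_subtype _)
  have hπN (n : H) (hn : n ∈ N) : π n = ⟨n, hn⟩ := congr($hπ ⟨n, hn⟩)
  -- Averaging π over the Casimir element Λ₁ ⊗ S(Λ₂) makes it `H`-linear.
  have key (h m : H) : ∑ j ∈ (ℛ k Λ).index, (ℛ k Λ).left j *
      (π (antipode k ((ℛ k Λ).right j) * (h * m)) : H) = h * ∑ j ∈ (ℛ k Λ).index,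
      (ℛ k Λ).left j * (π (antipode k ((ℛ k Λ).right j) * m) : H) := by
    have := congrArg (LinearMap.mul' k H ∘ₗ ((N.restrictScalars k).subtype ∘ₗ π ∘ₗ
      LinearMap.mulRight k m).lTensor H) (hlam.casimir_comm hΛ hnorm h)
    simp only [map_sum, LinearMap.comp_apply, LinearMap.lTensor_tmul, LinearMap.mulRight_apply,
      LinearMap.mul'_apply, Submodule.subtype_apply] at this
    rw [Finset.mul_sum]
    simpa only [mul_assoc] using this.symm
  let P : H →ₗ[H] N :=
    { toFun := fun m => (counit (R := k) Λ)⁻¹ • ∑ j ∈ (ℛ k Λ).index, (ℛ k Λ).left j •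
        (⟨π (antipode k ((ℛ k Λ).right j) * m), (π _).2⟩ : N)
      map_add' := fun x y => by
        rw [← smul_add, ← Finset.sum_add_distrib]
        congr 1
        refine Finset.sum_congr rfl fun j _ => ?_
        rw [← smul_add]
        congr 1
        ext
        simp [mul_add]
      map_smul' := fun h m => by
        ext
        simpa using congr((counit (R := k) Λ)⁻¹ • $(key h m)) }
  refine ⟨_, LinearMap.isCompl_of_proj (f := P) fun n => ?_⟩
  -- On `N` the map π is the identity, so only Λ₁ S(Λ₂) = ε(Λ) remains.
  have h1 : ∑ j ∈ (ℛ k Λ).index, (ℛ k Λ).left j *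
      (π (antipode k ((ℛ k Λ).right j) * n) : H) = counit (R := k) Λ • (n : H) := by
    rw [← one_mul (n : H), ← smul_mul_assoc, ← sum_mul_antipode_eq_smul (ℛ k Λ), Finset.sum_mul]
    refine Finset.sum_congr rfl fun j _ => ?_
    rw [one_mul, mul_assoc]
    exact congr((ℛ k Λ).left j * ($(hπN _ (N.smul_mem (antipode k ((ℛ k Λ).right j)) n.2)) : H))
  have h2 : (P n : H) = (counit (R := k) Λ)⁻¹ • ∑ j ∈ (ℛ k Λ).index, (ℛ k Λ).left j *
      (π (antipode k ((ℛ k Λ).right j) * n) : H) := by simp [P]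
  exact Subtype.ext (by rw [h2, h1, smul_smul, inv_mul_cancel₀ hε, one_smul])

end Semisimple

/-! ### Passage to the dual: actions and pairings -/

section Transfer

variable {k H : Type*} [Field k] [Ring H] [HopfAlgebra k H]

theorem comul_antipodeInv [FiniteDimensional k H]
    (hS : Function.Injective (antipode k : H →ₗ[k] H)) (h : H) :
    comul (R := k) (antipodeInv k H h) =
      ∑ i ∈ (ℛ k h).index,
        antipodeInv k H ((ℛ k h).right i) ⊗ₜ antipodeInv k H ((ℛ k h).left i) := by
  have h1 := comul_antipode (k := k) (antipodeInv k H h)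
  rw [antipode_antipodeInv hS] at h1
  have h2 := congrArg ((TensorProduct.comm k H H).toLinearMap ∘ₗ
    TensorProduct.map (antipodeInv k H) (antipodeInv k H)) h1
  have h3 (t : H ⊗[k] H) : TensorProduct.map (antipodeInv k H) (antipodeInv k H)
      (TensorProduct.map (antipode k) (antipode k) t) = t := by
    induction t with
    | zero => simp
    | add a b ha hb => simp only [map_add, ha, hb]
    | tmul a b => simp only [TensorProduct.map_tmul, antipodeInv_antipode hS]
  rw [LinearMap.comp_apply, LinearMap.comp_apply, h3, LinearEquiv.coe_coe,
    TensorProduct.comm_comm, comul_eq_sum h] at h2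
  simpa only [map_sum, TensorProduct.map_tmul, TensorProduct.comm_tmul] using h2.symm

theorem counit_antipodeInv [FiniteDimensional k H]
    (hS : Function.Injective (antipode k : H →ₗ[k] H)) (h : H) :
    counit (R := k) (antipodeInv k H h) = counit h := by
  rw [← counit_antipode, antipode_antipodeInv hS]

theorem antipodeInv_one [FiniteDimensional k H]
    (hS : Function.Injective (antipode k : H →ₗ[k] H)) : antipodeInv k H 1 = 1 :=
  hS (by rw [antipode_antipodeInv hS, antipode_one])

theorem antipodeInv_mul [FiniteDimensional k H]
    (hS : Function.Injective (antipode k : H →ₗ[k] H)) (x y : H) :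
    antipodeInv k H (x * y) = antipodeInv k H y * antipodeInv k H x :=
  hS (by simp only [antipode_mul_antidistrib, antipode_antipodeInv hS])

namespace Actions

theorem coregular_left_apply (h : H) (p : Module.Dual k H) (x : H) :
    (coregular k H).left h p x = p (antipode k h * x) := rfl

theorem coregular_right_apply (h : H) (p : Module.Dual k H) (x : H) :
    (coregular k H).right h p x = p (x * antipodeInv k H h) := rfl

theorem unit_left_apply (h : H) (c : k) : (unit k H).left h c = counit (R := k) h * c := rfl

theorem unit_right_apply (h : H) (c : k) : (unit k H).right h c = counit (R := k) h * c := rfl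

variable {X Y : Type*} [AddCommGroup X] [Module k X] [AddCommGroup Y] [Module k Y]

theorem tensor_left_tmul (A : Actions k H X) (B : Actions k H Y) (h : H) (x : X) (y : Y) :
    (A.tensor B).left h (x ⊗ₜ y) = ∑ i ∈ (ℛ k h).index,
      A.left ((ℛ k h).left i) x ⊗ₜ B.left ((ℛ k h).right i) y := by
  simp [tensor, comul_eq_sum h]

theorem tensor_right_tmul (A : Actions k H X) (B : Actions k H Y) (h : H) (x : X) (y : Y) :
    (A.tensor B).right h (x ⊗ₜ y) = ∑ i ∈ (ℛ k h).index,
      A.right ((ℛ k h).left i) x ⊗ₜ B.right ((ℛ k h).right i) y := by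
  simp [tensor, comul_eq_sum h]

theorem coregular_isBimodule [FiniteDimensional k H]
    (hS : Function.Injective (antipode k : H →ₗ[k] H)) : (coregular k H).IsBimodule where
  left_one p := by ext x; simp [coregular_left_apply]
  left_mul g h p := by
    ext x; simp [coregular_left_apply, antipode_mul_antidistrib, mul_assoc]
  right_one p := by ext x; simp [coregular_right_apply, antipodeInv_one hS]
  right_mul g h p := by
    ext x; simp [coregular_right_apply, antipodeInv_mul hS, mul_assoc]
  left_right g h p := by
    ext x; simp [coregular_right_apply, coregular_left_apply, mul_assoc]

end Actions

variable [FiniteDimensional k H]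

@[simp] theorem nestedDual_tmul_tmul (p q : Module.Dual k H) (x y : H) :
    nestedDual k H (p ⊗ₜ q) (x ⊗ₜ y) = q x * p y := by
  simp [nestedDual, TensorProduct.dualDistribEquiv, TensorProduct.dualDistribEquivOfBasis]

theorem nestedDual_ext {s t : Module.Dual k H ⊗[k] Module.Dual k H}
    (h : ∀ x y, nestedDual k H s (x ⊗ₜ y) = nestedDual k H t (x ⊗ₜ y)) : s = t :=
  (nestedDual k H).injective (TensorProduct.ext' h)

/-- The reversal of Δ by S matches the reversal in the nested pairing. -/
theorem nestedDual_tensor_left (h : H) (t : Module.Dual k H ⊗[k] Module.Dual k H)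
    (w : H ⊗[k] H) :
    nestedDual k H (((Actions.coregular k H).tensor (Actions.coregular k H)).left h t) w =
      nestedDual k H t (comul (antipode k h) * w) := by
  induction t with
  | zero => simp
  | add a b ha hb => simp only [map_add, LinearMap.add_apply, ha, hb]
  | tmul p q =>
    induction w with
    | zero => simp
    | add a b ha hb => simp only [mul_add, map_add, ha, hb]
    | tmul x y =>
      rw [Actions.tensor_left_tmul, comul_antipode, comul_eq_sum h]
      simp only [map_sum, LinearMap.sum_apply, nestedDual_tmul_tmul, Finset.sum_mul,
        TensorProduct.comm_tmul, TensorProduct.map_tmul, Algebra.TensorProduct.tmul_mul_tmul,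
        Actions.coregular_left_apply]

theorem nestedDual_tensor_right (hS : Function.Injective (antipode k : H →ₗ[k] H)) (h : H)
    (t : Module.Dual k H ⊗[k] Module.Dual k H) (w : H ⊗[k] H) :
    nestedDual k H (((Actions.coregular k H).tensor (Actions.coregular k H)).right h t) w =
      nestedDual k H t (w * comul (antipodeInv k H h)) := by
  induction t with
  | zero => simp
  | add a b ha hb => simp only [map_add, LinearMap.add_apply, ha, hb]
  | tmul p q =>
    induction w with
    | zero => simp
    | add a b ha hb => simp only [add_mul, map_add, ha, hb]
    | tmul x y =>
      rw [Actions.tensor_right_tmul, comul_antipodeInv hS]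
      simp only [map_sum, LinearMap.sum_apply, nestedDual_tmul_tmul, Finset.mul_sum,
        Algebra.TensorProduct.tmul_mul_tmul, Actions.coregular_right_apply]

/-- The identification of `H* ⊗ (H* ⊗ H*)` with `(H ⊗ (H ⊗ H))*`. -/
noncomputable def tripleDual :
    Module.Dual k H ⊗[k] (Module.Dual k H ⊗[k] Module.Dual k H) ≃ₗ[k]
      Module.Dual k (H ⊗[k] (H ⊗[k] H)) :=
  TensorProduct.congr (LinearEquiv.refl k _) (nestedDual k H) ≪≫ₗ
    TensorProduct.dualDistribEquiv k H (H ⊗[k] H)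

@[simp] theorem tripleDual_tmul_tmul (p : Module.Dual k H)
    (t : Module.Dual k H ⊗[k] Module.Dual k H) (z : H) (w : H ⊗[k] H) :
    tripleDual (p ⊗ₜ t) (z ⊗ₜ w) = p z * nestedDual k H t w := by
  simp [tripleDual, TensorProduct.dualDistribEquiv, TensorProduct.dualDistribEquivOfBasis]

/-- The order z, x, y makes the pairing nested overall: p ⊗ (q ⊗ r) takes the value p(z) r(x) q(y).
-/
theorem tripleDual_ext {s t : Module.Dual k H ⊗[k] (Module.Dual k H ⊗[k] Module.Dual k H)}
    (h : ∀ x y z, tripleDual s (z ⊗ₜ (x ⊗ₜ y)) = tripleDual t (z ⊗ₜ (x ⊗ₜ y))) : s = t :=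
  tripleDual.injective (TensorProduct.ext_threefold' fun z x y => h x y z)

/-! ### The Frobenius axioms for F -/

section CoregularFrobenius

variable (Λ : H) (lam : Module.Dual k H)

theorem coregularFrobenius_mul_apply (t : Module.Dual k H ⊗[k] Module.Dual k H) (x : H) :
    (coregularFrobenius Λ lam).mul t x = nestedDual k H t (comul x) := rfl

theorem coregularFrobenius_mul_tmul_apply (p q : Module.Dual k H) (x : H) :
    (coregularFrobenius Λ lam).mul (p ⊗ₜ q) x =
      ∑ i ∈ (ℛ k x).index, q ((ℛ k x).left i) * p ((ℛ k x).right i) := by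
  rw [coregularFrobenius_mul_apply, comul_eq_sum, map_sum]
  simp only [nestedDual_tmul_tmul]

theorem coregularFrobenius_unit_apply (c : k) (x : H) :
    (coregularFrobenius Λ lam).unit c x = c * counit x := rfl

theorem nestedDual_coregularFrobenius_comul (p : Module.Dual k H) (w : H ⊗[k] H) :
    nestedDual k H ((coregularFrobenius Λ lam).comul p) w = p (preComul lam w) := by
  simp [coregularFrobenius]

theorem coregularFrobenius_counit_apply (p : Module.Dual k H) :
    (coregularFrobenius Λ lam).counit p = p Λ := rfl

theorem coregularFrobenius_mul_assoc :
    (coregularFrobenius Λ lam).mul ∘ₗ (coregularFrobenius Λ lam).mul.rTensor _ =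
      (coregularFrobenius Λ lam).mul ∘ₗ (coregularFrobenius Λ lam).mul.lTensor _ ∘ₗ
        (TensorProduct.assoc k _ _ _).toLinearMap := by
  refine TensorProduct.ext_threefold fun p q r => LinearMap.ext fun x => ?_
  have := sum_coassoc (tripleDual (r ⊗ₜ[k] (p ⊗ₜ[k] q))) x
  simp only [tripleDual_tmul_tmul, nestedDual_tmul_tmul] at this
  simp only [LinearMap.comp_apply, LinearMap.rTensor_tmul, LinearMap.lTensor_tmul,
    LinearEquiv.coe_coe, TensorProduct.assoc_tmul, coregularFrobenius_mul_tmul_apply,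
    Finset.mul_sum, Finset.sum_mul, mul_assoc]
  exact this.symm

theorem coregularFrobenius_unit_mul :
    (coregularFrobenius Λ lam).mul ∘ₗ (coregularFrobenius Λ lam).unit.rTensor _ =
      (TensorProduct.lid k _).toLinearMap := by
  refine TensorProduct.ext' fun c p => LinearMap.ext fun x => ?_
  simp only [LinearMap.comp_apply, LinearMap.rTensor_tmul, coregularFrobenius_mul_tmul_apply,
    coregularFrobenius_unit_apply, LinearEquiv.coe_coe, TensorProduct.lid_tmul,
    LinearMap.smul_apply, smul_eq_mul]
  conv_rhs => rw [← sum_counit_smul_left (k := k) x, map_sum, Finset.mul_sum]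
  refine Finset.sum_congr rfl fun i _ => ?_
  rw [map_smul, smul_eq_mul]
  ring

theorem coregularFrobenius_mul_unit :
    (coregularFrobenius Λ lam).mul ∘ₗ (coregularFrobenius Λ lam).unit.lTensor _ =
      (TensorProduct.rid k _).toLinearMap := by
  refine TensorProduct.ext' fun p c => LinearMap.ext fun x => ?_
  simp only [LinearMap.comp_apply, LinearMap.lTensor_tmul, coregularFrobenius_mul_tmul_apply,
    coregularFrobenius_unit_apply, LinearEquiv.coe_coe, TensorProduct.rid_tmul,
    LinearMap.smul_apply, smul_eq_mul]
  conv_rhs => rw [← sum_counit_smul_right (k := k) x, map_sum, Finset.mul_sum]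
  refine Finset.sum_congr rfl fun i _ => ?_
  rw [map_smul, smul_eq_mul]
  ring

theorem tripleDual_assoc_tmul (u : Module.Dual k H ⊗[k] Module.Dual k H) (q : Module.Dual k H)
    (x y z : H) :
    tripleDual (TensorProduct.assoc k _ _ _ (u ⊗ₜ q)) (z ⊗ₜ (x ⊗ₜ y)) =
      q x * nestedDual k H u (y ⊗ₜ z) := by
  induction u with
  | zero => simp
  | add a b ha hb => simp only [TensorProduct.add_tmul, map_add, LinearMap.add_apply, ha, hb,
      mul_add]
  | tmul a b => simp; ring

theorem coregularFrobenius_comul_coassoc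
    (hassoc : ∀ x y z, preComul lam (x ⊗ₜ preComul lam (y ⊗ₜ z)) =
      preComul lam (preComul lam (x ⊗ₜ y) ⊗ₜ z)) :
    (TensorProduct.assoc k _ _ _).toLinearMap ∘ₗ (coregularFrobenius Λ lam).comul.rTensor _ ∘ₗ
      (coregularFrobenius Λ lam).comul =
      (coregularFrobenius Λ lam).comul.lTensor _ ∘ₗ (coregularFrobenius Λ lam).comul := by
  have h1 (t : Module.Dual k H ⊗[k] Module.Dual k H) (x y z : H) :
      tripleDual (TensorProduct.assoc k _ _ _ ((coregularFrobenius Λ lam).comul.rTensor _ t))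
        (z ⊗ₜ (x ⊗ₜ y)) = nestedDual k H t (x ⊗ₜ preComul lam (y ⊗ₜ z)) := by
    induction t with
    | zero => simp
    | add a b ha hb => simp only [map_add, LinearMap.add_apply, ha, hb]
    | tmul p q =>
      rw [LinearMap.rTensor_tmul, tripleDual_assoc_tmul, nestedDual_coregularFrobenius_comul,
        nestedDual_tmul_tmul]
  have h2 (t : Module.Dual k H ⊗[k] Module.Dual k H) (x y z : H) :
      tripleDual ((coregularFrobenius Λ lam).comul.lTensor _ t) (z ⊗ₜ (x ⊗ₜ y)) =
        nestedDual k H t (preComul lam (x ⊗ₜ y) ⊗ₜ z) := by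
    induction t with
    | zero => simp
    | add a b ha hb => simp only [map_add, LinearMap.add_apply, ha, hb]
    | tmul p q =>
      rw [LinearMap.lTensor_tmul, tripleDual_tmul_tmul, nestedDual_coregularFrobenius_comul,
        nestedDual_tmul_tmul, mul_comm]
  refine LinearMap.ext fun p => tripleDual_ext fun x y z => ?_
  simp only [LinearMap.comp_apply, LinearEquiv.coe_coe]
  rw [h1, h2, nestedDual_coregularFrobenius_comul, nestedDual_coregularFrobenius_comul, hassoc]

theorem coregularFrobenius_counit_comul (h : ∀ x, preComul lam (x ⊗ₜ Λ) = x) :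
    (TensorProduct.lid k _).toLinearMap ∘ₗ (coregularFrobenius Λ lam).counit.rTensor _ ∘ₗ
      (coregularFrobenius Λ lam).comul = LinearMap.id := by
  have h1 (t : Module.Dual k H ⊗[k] Module.Dual k H) (x : H) :
      TensorProduct.lid k _ ((coregularFrobenius Λ lam).counit.rTensor _ t) x =
        nestedDual k H t (x ⊗ₜ Λ) := by
    induction t with
    | zero => simp
    | add a b ha hb => simp only [map_add, LinearMap.add_apply, ha, hb]
    | tmul p q => simp [coregularFrobenius_counit_apply, mul_comm]
  refine LinearMap.ext fun p => LinearMap.ext fun x => ?_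
  simp only [LinearMap.comp_apply, LinearEquiv.coe_coe]
  rw [h1, nestedDual_coregularFrobenius_comul, h, LinearMap.id_apply]

theorem coregularFrobenius_comul_counit (h : ∀ y, preComul lam (Λ ⊗ₜ y) = y) :
    (TensorProduct.rid k _).toLinearMap ∘ₗ (coregularFrobenius Λ lam).counit.lTensor _ ∘ₗ
      (coregularFrobenius Λ lam).comul = LinearMap.id := by
  have h1 (t : Module.Dual k H ⊗[k] Module.Dual k H) (y : H) :
      TensorProduct.rid k _ ((coregularFrobenius Λ lam).counit.lTensor _ t) y =
        nestedDual k H t (Λ ⊗ₜ y) := by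
    induction t with
    | zero => simp
    | add a b ha hb => simp only [map_add, LinearMap.add_apply, ha, hb]
    | tmul p q => simp [coregularFrobenius_counit_apply]
  refine LinearMap.ext fun p => LinearMap.ext fun x => ?_
  simp only [LinearMap.comp_apply, LinearEquiv.coe_coe]
  rw [h1, nestedDual_coregularFrobenius_comul, h, LinearMap.id_apply]

theorem coregularFrobenius_frobenius_left
    (h : ∀ x y, comul (R := k) (preComul lam (x ⊗ₜ y)) =
      ∑ j ∈ (ℛ k y).index, preComul lam (x ⊗ₜ (ℛ k y).left j) ⊗ₜ (ℛ k y).right j) :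
    (coregularFrobenius Λ lam).mul.rTensor _ ∘ₗ (TensorProduct.assoc k _ _ _).symm.toLinearMap ∘ₗ
      (coregularFrobenius Λ lam).comul.lTensor _ =
      (coregularFrobenius Λ lam).comul ∘ₗ (coregularFrobenius Λ lam).mul := by
  have h1 (p : Module.Dual k H) (t : Module.Dual k H ⊗[k] Module.Dual k H) (x y : H) :
      nestedDual k H ((coregularFrobenius Λ lam).mul.rTensor _
        ((TensorProduct.assoc k _ _ _).symm (p ⊗ₜ t))) (x ⊗ₜ y) =
        ∑ j ∈ (ℛ k y).index, nestedDual k H t (x ⊗ₜ (ℛ k y).left j) * p ((ℛ k y).right j) := by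
    induction t with
    | zero => simp
    | add a b ha hb => simp only [TensorProduct.tmul_add, map_add, LinearMap.add_apply, ha, hb,
        add_mul, Finset.sum_add_distrib]
    | tmul q r =>
      simp only [TensorProduct.assoc_symm_tmul, LinearMap.rTensor_tmul, nestedDual_tmul_tmul,
        coregularFrobenius_mul_tmul_apply, Finset.mul_sum, mul_assoc]
  refine TensorProduct.ext' fun p q => nestedDual_ext fun x y => ?_
  simp only [LinearMap.comp_apply, LinearEquiv.coe_coe, LinearMap.lTensor_tmul]
  rw [h1, nestedDual_coregularFrobenius_comul, coregularFrobenius_mul_apply, h, map_sum]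
  simp only [nestedDual_coregularFrobenius_comul, nestedDual_tmul_tmul]

theorem coregularFrobenius_frobenius_right :
    (coregularFrobenius Λ lam).mul.lTensor _ ∘ₗ (TensorProduct.assoc k _ _ _).toLinearMap ∘ₗ
      (coregularFrobenius Λ lam).comul.rTensor _ =
      (coregularFrobenius Λ lam).comul ∘ₗ (coregularFrobenius Λ lam).mul := by
  have h1 (q : Module.Dual k H) (t : Module.Dual k H ⊗[k] Module.Dual k H) (x y : H) :
      nestedDual k H ((coregularFrobenius Λ lam).mul.lTensor _
        (TensorProduct.assoc k _ _ _ (t ⊗ₜ q))) (x ⊗ₜ y) =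
        ∑ i ∈ (ℛ k x).index, q ((ℛ k x).left i) * nestedDual k H t ((ℛ k x).right i ⊗ₜ y) := by
    induction t with
    | zero => simp
    | add a b ha hb => simp only [TensorProduct.add_tmul, map_add, LinearMap.add_apply, ha, hb,
        mul_add, Finset.sum_add_distrib]
    | tmul p r =>
      simp only [TensorProduct.assoc_tmul, LinearMap.lTensor_tmul, nestedDual_tmul_tmul,
        coregularFrobenius_mul_tmul_apply, Finset.sum_mul, mul_assoc]
  refine TensorProduct.ext' fun p q => nestedDual_ext fun x y => ?_
  simp only [LinearMap.comp_apply, LinearEquiv.coe_coe, LinearMap.rTensor_tmul]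
  rw [h1, nestedDual_coregularFrobenius_comul, coregularFrobenius_mul_apply, comul_preComul_tmul,
    map_sum]
  simp only [nestedDual_coregularFrobenius_comul, nestedDual_tmul_tmul]

theorem coregularFrobenius_mul_comp_comul :
    (coregularFrobenius Λ lam).mul ∘ₗ (coregularFrobenius Λ lam).comul =
      lam 1 • LinearMap.id := by
  refine LinearMap.ext fun p => LinearMap.ext fun x => ?_
  rw [LinearMap.comp_apply, coregularFrobenius_mul_apply, nestedDual_coregularFrobenius_comul,
    preComul_comul, map_smul]
  rfl

theorem coregularFrobenius_counit_comp_unit :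
    (coregularFrobenius Λ lam).counit ∘ₗ (coregularFrobenius Λ lam).unit =
      counit (R := k) Λ • LinearMap.id := by
  ext
  simp [coregularFrobenius_counit_apply, coregularFrobenius_unit_apply]

variable {Λ lam}

theorem IsRightCointegral.isFrobeniusAlgebra (hlam : IsRightCointegral lam)
    (hΛ : IsLeftIntegral k Λ) (hnorm : lam Λ = 1)
    (hΛr : ∀ h, Λ * h = counit (R := k) h • Λ) :
    IsFrobeniusAlgebra (Actions.coregular k H) (coregularFrobenius Λ lam) :=
  have hS := hlam.antipode_injective hΛ hnorm
  { isBimodule := Actions.coregular_isBimodule hS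
    mul_hom :=
      { left := fun h t => LinearMap.ext fun x => by
          rw [coregularFrobenius_mul_apply, nestedDual_tensor_left, ← Bialgebra.comul_mul]
          rfl
        right := fun h t => LinearMap.ext fun x => by
          rw [coregularFrobenius_mul_apply, nestedDual_tensor_right hS, ← Bialgebra.comul_mul]
          rfl }
    unit_hom :=
      { left := fun h c => LinearMap.ext fun x => by
          rw [Actions.coregular_left_apply, coregularFrobenius_unit_apply,
            coregularFrobenius_unit_apply, Actions.unit_left_apply, Bialgebra.counit_mul,
            counit_antipode]
          ring
        right := fun h c => LinearMap.ext fun x => by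
          rw [Actions.coregular_right_apply, coregularFrobenius_unit_apply,
            coregularFrobenius_unit_apply, Actions.unit_right_apply, Bialgebra.counit_mul,
            counit_antipodeInv hS]
          ring }
    comul_hom :=
      { left := fun h p => nestedDual_ext fun x y => by
          rw [nestedDual_tensor_left, nestedDual_coregularFrobenius_comul,
            nestedDual_coregularFrobenius_comul, Actions.coregular_left_apply,
            hlam.preComul_comul_mul hS]
        right := fun h p => nestedDual_ext fun x y => by
          rw [nestedDual_tensor_right hS, nestedDual_coregularFrobenius_comul,
            nestedDual_coregularFrobenius_comul, Actions.coregular_right_apply,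
            hlam.preComul_mul_comul hΛ hnorm hΛr] }
    counit_hom :=
      { left := fun h p => by
          rw [coregularFrobenius_counit_apply, Actions.coregular_left_apply, hΛ, map_smul,
            counit_antipode]
          rfl
        right := fun h p => by
          rw [coregularFrobenius_counit_apply, Actions.coregular_right_apply, hΛr, map_smul,
            counit_antipodeInv hS]
          rfl }
    mul_assoc := coregularFrobenius_mul_assoc Λ lam
    unit_mul := coregularFrobenius_unit_mul Λ lam
    mul_unit := coregularFrobenius_mul_unit Λ lam
    comul_coassoc := coregularFrobenius_comul_coassoc Λ lam (hlam.preComul_assoc hS)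
    counit_comul := coregularFrobenius_counit_comul Λ lam (preComul_integral_right hΛ hnorm)
    comul_counit := coregularFrobenius_comul_counit Λ lam (hlam.preComul_integral_left hΛ hnorm)
    frobenius_left := coregularFrobenius_frobenius_left Λ lam (hlam.comul_preComul_tmul hS)
    frobenius_right := coregularFrobenius_frobenius_right Λ lam }

end CoregularFrobenius

end Transfer

end HopfBimod

theorem mainTheorem6 {k H : Type*} [Field k] [IsAlgClosed k] [CharZero k]
    [Ring H] [HopfAlgebra k H] [FiniteDimensional k H]
    (R : H ⊗[k] H) (v : H)
    (hR : HopfBimod.IsRMatrix R)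
    (hv : HopfBimod.IsRibbonElement R v)
    (hfact : HopfBimod.IsFactorizable R)
    (Λ : H) (lam : Module.Dual k H)
    (hΛ : HopfBimod.IsLeftIntegral k Λ)
    (hlam : HopfBimod.IsRightCointegral lam)
    (hnorm : lam Λ = 1) :
    HopfBimod.IsFrobeniusAlgebra
        (HopfBimod.Actions.coregular k H) (HopfBimod.coregularFrobenius Λ lam) ∧
      (HopfBimod.coregularFrobenius Λ lam).counit ∘ₗ (HopfBimod.coregularFrobenius Λ lam).unit =
        Coalgebra.counit (R := k) Λ • LinearMap.id ∧
      (HopfBimod.coregularFrobenius Λ lam).mul ∘ₗ (HopfBimod.coregularFrobenius Λ lam).comul =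
        lam 1 • LinearMap.id ∧
      (HopfBimod.IsSpecialFrobeniusAlgebra
          (HopfBimod.Actions.coregular k H) (HopfBimod.coregularFrobenius Λ lam) ↔
        IsSemisimpleRing H) := by
  have hΛr := hlam.unimodular hR hv hfact hΛ hnorm
  have hF := hlam.isFrobeniusAlgebra hΛ hnorm hΛr
  refine ⟨hF, HopfBimod.coregularFrobenius_counit_comp_unit Λ lam,
    HopfBimod.coregularFrobenius_mul_comp_comul Λ lam, fun h => ?_, fun h => ?_⟩
  · obtain ⟨ξ, hξ, h1⟩ := h.counit_unit
    rw [HopfBimod.coregularFrobenius_counit_comp_unit] at h1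
    -- The scalar ξ alone suffices in this direction: it equals ε(Λ).
    refine hlam.isSemisimpleRing hΛ hnorm fun h0 => hξ ?_
    simpa [h0] using congr($h1.symm 1)
  · have hε := hlam.counit_ne_zero hΛ hnorm
    exact ⟨hF, ⟨_, hε, HopfBimod.coregularFrobenius_counit_comp_unit Λ lam⟩,
      ⟨_, hlam.apply_one_ne_zero hR hv hfact hΛ hnorm hε,
        HopfBimod.coregularFrobenius_mul_comp_comul Λ lam⟩⟩
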